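/- Let $s>1/2$, $L>0$ and let $\mathcal S(s,L)$ be the class of continuous probability densities $f:\mathbb R\to[0,\infty)$ with $$\int_{\mathbb R} |\mathcal F[f](\omega)|^2\,|\omega|^{2s}\,d\omega \le 2\pi L^2,\qquad \mathcal F[f](\omega)=\int_{\mathbb R} e^{i\omega x} f(x)\,dx .$$ A Markov kernel $Q$ from $\mathbb R$ to a measurable space $(\mathfrak Z,\mathscr Z)$ is called $\alpha$-private (pure local $\alpha$-differentially private) if $Q(A\mid x)\le e^{\alpha}\,Q(A\mid x')$ for all $x,x'\in\mathbb R$ and all $A\in\mathscr Z$. For every $\alpha>0$ there is a constant $C(\alpha)>0$, depending only on $\alpha$, $s$ and $L$, such that for every $t\in\mathbb R$ and every integer $n\ge 1$ $$\inf_{Q_1,\dots,Q_n,\ \widehat\ell}\ \ \sup_{f\in\mathcal S(s,L)} \mathbf E_f\big[(\widehat\ell(Z_1,\dots,Z_n)-f(t))^2\big]\ \ge\ C(\alpha)\, n^{-\frac{2s-1}{2s+1}} .$$ Here $X_1,\dots,X_n$ are i.i.d. with density $f$; given $X_1,\dots,X_n$, the private views $Z_1,\dots,Z_n$ are independent with $Z_i\sim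 Q_i(\cdot\mid X_i)$; the infimum is over all measurable spaces $\mathfrak Z_i$, all $\alpha$-private Markov kernels $Q_i$ from $\mathbb R$ to $\mathfrak Z_i$, and all measurable functions $\widehat\ell:\mathfrak Z_1\times\dots\times\mathfrak Z_n\to\mathbb R$ (estimators). -/

import Mathlib

open MeasureTheory ProbabilityTheory
open scoped ENNReal

universe u

noncomputable section

namespace PrivateDensity

/-- A Markov kernel `Q` from `𝔛` to `𝔷` provides a local `(α, β)`-differentially private view if
`Q(A | x) ≤ exp(α) Q(A | x') + β` for all `x, x'` and all measurable `A`. -/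
def IsLocallyDP {𝔛 : Type*} {𝔷 : Type*} [MeasurableSpace 𝔛] [MeasurableSpace 𝔷]
    (α β : ℝ) (Q : Kernel 𝔛 𝔷) : Prop :=
  ∀ x x' : 𝔛, ∀ A : Set 𝔷, MeasurableSet A →
    Q x A ≤ ENNReal.ofReal (Real.exp α) * Q x' A + ENNReal.ofReal β

/-- The Fourier transform `𝓕[f](ω) = ∫ exp(iωx) f(x) dx`. -/
def fourierTransform (f : ℝ → ℝ) (ω : ℝ) : ℂ :=
  ∫ x : ℝ, Complex.exp (Complex.I * ω * x) * (f x : ℂ)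

/-- The class `𝓢(s, L)` of probability densities `f` on `ℝ` with
`∫ |𝓕[f](ω)|² |ω|^{2s} dω ≤ 2πL²`. For `s > 1/2` every such density agrees almost everywhere with
exactly one continuous function; the point values `f t` are those of that version, so the elements
of the class are taken to be continuous. -/
def sobolevClass (s L : ℝ) : Set (ℝ → ℝ) :=
  {f | Continuous f ∧ (∀ x, 0 ≤ f x) ∧ Integrable f ∧ ∫ x, f x = 1 ∧
    ∫⁻ ω : ℝ, ENNReal.ofReal (‖fourierTransform f ω‖ ^ 2 * |ω| ^ (2 * s)) ≤
      ENNReal.ofReal (2 * Real.pi * L ^ 2)}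

/-- The probability measure on `ℝ` with Lebesgue density `f`: the law of one observation `X_i`. -/
def densityLaw (f : ℝ → ℝ) : Measure ℝ :=
  volume.withDensity fun x => ENNReal.ofReal (f x)

/-- The joint law of the private views `Z_1, …, Z_n`, where `X_1, …, X_n` are i.i.d. with density
`f` and, independently over `i`, `Z_i` is drawn from `Q_i(· | X_i)`. -/
def viewsLaw {n : ℕ} {𝔷 : Fin n → Type*} [∀ i, MeasurableSpace (𝔷 i)]
    (Q : ∀ i, Kernel ℝ (𝔷 i)) (f : ℝ → ℝ) : Measure (∀ i, 𝔷 i) :=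
  Measure.pi fun i => (densityLaw f).bind (Q i)

/-- The mean squared error `𝔼[(ℓ(Z_1, …, Z_n) - f(t))²]`, with values in `[0, ∞]`. -/
def meanSquaredError {n : ℕ} {𝔷 : Fin n → Type*} [∀ i, MeasurableSpace (𝔷 i)]
    (Q : ∀ i, Kernel ℝ (𝔷 i)) (ℓ : (∀ i, 𝔷 i) → ℝ) (t : ℝ) (f : ℝ → ℝ) : ℝ≥0∞ :=
  ∫⁻ z, ENNReal.ofReal ((ℓ z - f t) ^ 2) ∂(viewsLaw Q f)

/-- The private minimax risk for estimating `f t` over the class `P` from `n` observations: the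
infimum over all output spaces, all non-interactive local `(α, β)`-differentially private
mechanisms (each data holder may use a channel of his own) and all estimators based on the private
views, of the largest mean squared error over `f ∈ P`. -/
def privateMinimaxRisk (α β : ℝ) (n : ℕ) (t : ℝ) (P : Set (ℝ → ℝ)) : ℝ≥0∞ :=
  ⨅ (𝔷 : Fin n → Type u) (_ : ∀ i, MeasurableSpace (𝔷 i)) (Q : ∀ i, Kernel ℝ (𝔷 i))
    (_ : ∀ i, IsMarkovKernel (Q i)) (_ : ∀ i, IsLocallyDP α β (Q i))
    (ℓ : (∀ i, 𝔷 i) → ℝ) (_ : Measurable ℓ),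
    ⨆ f ∈ P, meanSquaredError Q ℓ t f

end PrivateDensity

end

/-!
Fix `t` and compare a wide Gaussian density `f` centred at `t` with the contaminated density
`(1 - ε) f + ε g`, where `g` is centred at `t` with variance smaller by a factor `h`. The seminorm
defining the Sobolev class obeys the triangle inequality and has size `h ^ (-(s + 1/2) / 2)` at `g`,
so the mixture stays in the class for `ε = h ^ ((s + 1/2) / 2)`, while its value at `t` differs from
`f t` by a multiple of `ε h ^ (-1/2)`.

Privacy bounds the likelihood ratio between the views of `g` and of `f` by `e ^ α`, whatever `g` is.
The second moment of the likelihood ratio of a contaminated view is therefore at most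
`1 + ε² e ^ α`, and that of `n` independent views at most `exp (n ε² e ^ α)`. If this is bounded,
Cauchy–Schwarz shows that no estimator has a risk much smaller than the squared gap `ε² / h` at both
densities. Balancing `n ε² ~ 1`, that is `h ~ n ^ (-1 / (s + 1/2))`, makes the squared gap
`h ^ (s - 1/2) ~ n ^ (-(2s - 1) / (2s + 1))`.
-/

namespace PrivateDensity

section LikelihoodRatio

variable {Ω : Type*} [MeasurableSpace Ω]

/-- The second moment of the likelihood ratio `dν/dμ` under `μ`, which is `1 + χ²(ν ‖ μ)` for
probability measures `ν ≪ μ`. Unlike the χ²-divergence itself, it is multiplicative over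
products. -/
noncomputable def rnDerivSqMoment (ν μ : Measure Ω) : ℝ≥0∞ :=
  ∫⁻ x, ν.rnDeriv μ x ^ 2 ∂μ

lemma sq_lintegral_mul_le (μ : Measure Ω) {f g : Ω → ℝ≥0∞} (hf : AEMeasurable f μ)
    (hg : AEMeasurable g μ) :
    (∫⁻ x, f x * g x ∂μ) ^ 2 ≤ (∫⁻ x, f x ^ 2 ∂μ) * ∫⁻ x, g x ^ 2 ∂μ := by
  have sq_rpow_half (a : ℝ≥0∞) : (a ^ (1 / 2 : ℝ)) ^ 2 = a := by
    rw [← ENNReal.rpow_mul_natCast]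
    norm_num
  have holder := ENNReal.lintegral_mul_le_Lp_mul_Lq μ Real.HolderConjugate.two_two hf hg
  simp only [ENNReal.rpow_two] at holder
  calc (∫⁻ x, f x * g x ∂μ) ^ 2
      ≤ ((∫⁻ x, f x ^ 2 ∂μ) ^ (1 / 2 : ℝ) * (∫⁻ x, g x ^ 2 ∂μ) ^ (1 / 2 : ℝ)) ^ 2 := by
        gcongr
        exact holder
    _ = (∫⁻ x, f x ^ 2 ∂μ) * ∫⁻ x, g x ^ 2 ∂μ := by rw [mul_pow, sq_rpow_half, sq_rpow_half]

lemma sq_lintegral_le_lintegral_sq (ν : Measure Ω) [IsProbabilityMeasure ν] {f : Ω → ℝ≥0∞}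
    (hf : AEMeasurable f ν) : (∫⁻ x, f x ∂ν) ^ 2 ≤ ∫⁻ x, f x ^ 2 ∂ν := by
  simpa using sq_lintegral_mul_le ν hf (aemeasurable_const (b := (1 : ℝ≥0∞)))

lemma sq_lintegral_le_rnDerivSqMoment_mul {μ ν : Measure Ω} [ν.HaveLebesgueDecomposition μ]
    (hνμ : ν ≪ μ) {f : Ω → ℝ≥0∞} (hf : AEMeasurable f μ) :
    (∫⁻ x, f x ∂ν) ^ 2 ≤ rnDerivSqMoment ν μ * ∫⁻ x, f x ^ 2 ∂μ := by
  rw [← lintegral_rnDeriv_mul hνμ hf]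
  exact sq_lintegral_mul_le μ (Measure.measurable_rnDeriv ν μ).aemeasurable hf

/-- The two-point constrained risk inequality: both `|ℓ - a|` and `|ℓ - b|` are integrated under
`ν`, and the first of these integrals is controlled by the risk of `ℓ` under `μ`. -/
lemma sq_sub_le_rnDerivSqMoment_mul_risk_add_risk {μ ν : Measure Ω} [IsProbabilityMeasure ν]
    [ν.HaveLebesgueDecomposition μ] (hνμ : ν ≪ μ) {ℓ : Ω → ℝ} (hℓ : Measurable ℓ) (a b : ℝ) :
    ENNReal.ofReal ((b - a) ^ 2) ≤
      2 * (rnDerivSqMoment ν μ * ∫⁻ x, ENNReal.ofReal ((ℓ x - a) ^ 2) ∂μ +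
        ∫⁻ x, ENNReal.ofReal ((ℓ x - b) ^ 2) ∂ν) := by
  have enorm_sq (x : ℝ) : ENNReal.ofReal (x ^ 2) = ‖x‖ₑ ^ 2 := by
    rw [← sq_abs, ENNReal.ofReal_pow (abs_nonneg x), ← Real.enorm_eq_ofReal_abs]
  simp only [enorm_sq]
  have triangle : ‖b - a‖ₑ ≤ (∫⁻ x, ‖ℓ x - a‖ₑ ∂ν) + ∫⁻ x, ‖ℓ x - b‖ₑ ∂ν :=
    calc ‖b - a‖ₑ = ∫⁻ _, ‖b - a‖ₑ ∂ν := by simp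
      _ ≤ ∫⁻ x, (‖ℓ x - a‖ₑ + ‖ℓ x - b‖ₑ) ∂ν := by
        refine lintegral_mono fun x => ?_
        simpa using enorm_sub_le (E := ℝ) (a := ℓ x - a) (b := ℓ x - b)
      _ = _ := lintegral_add_left (by fun_prop) _
  calc ‖b - a‖ₑ ^ 2
      ≤ ((∫⁻ x, ‖ℓ x - a‖ₑ ∂ν) + ∫⁻ x, ‖ℓ x - b‖ₑ ∂ν) ^ 2 := by gcongr
    _ ≤ 2 * ((∫⁻ x, ‖ℓ x - a‖ₑ ∂ν) ^ 2 + (∫⁻ x, ‖ℓ x - b‖ₑ ∂ν) ^ 2) := by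
      simpa [show (2 : ℝ) - 1 = 1 by norm_num] using
        ENNReal.rpow_add_le_mul_rpow_add_rpow (∫⁻ x, ‖ℓ x - a‖ₑ ∂ν) (∫⁻ x, ‖ℓ x - b‖ₑ ∂ν)
          one_le_two
    _ ≤ _ := by
      gcongr
      · exact sq_lintegral_le_rnDerivSqMoment_mul hνμ (by fun_prop)
      · exact sq_lintegral_le_lintegral_sq ν (by fun_prop)

lemma rnDeriv_le_of_le_smul {ρ μ : Measure Ω} [SigmaFinite μ] {c : ℝ≥0∞} (h : ρ ≤ c • μ) :
    ρ.rnDeriv μ ≤ᵐ[μ] fun _ => c := by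
  refine ae_le_of_forall_setLIntegral_le_of_sigmaFinite (Measure.measurable_rnDeriv ρ μ)
    fun A _ _ => ?_
  rw [setLIntegral_const]
  exact (Measure.setLIntegral_rnDeriv_le A).trans (h A)

lemma rnDerivSqMoment_le_of_le_smul {ρ μ : Measure Ω} [IsProbabilityMeasure ρ] [SigmaFinite μ]
    {c : ℝ≥0∞} (h : ρ ≤ c • μ) : rnDerivSqMoment ρ μ ≤ c :=
  calc ∫⁻ x, ρ.rnDeriv μ x ^ 2 ∂μ ≤ ∫⁻ x, c * ρ.rnDeriv μ x ∂μ := by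
        refine lintegral_mono_ae ?_
        filter_upwards [rnDeriv_le_of_le_smul h] with x hx
        rw [sq]
        gcongr
    _ = c * ∫⁻ x, ρ.rnDeriv μ x ∂μ := lintegral_const_mul _ (Measure.measurable_rnDeriv ρ μ)
    _ ≤ c := mul_le_of_le_one_right' (Measure.lintegral_rnDeriv_le.trans_eq measure_univ)

/-- The cross term of the square is a total mass, so the deviation from `1` is quadratic in the
weight `b` of the contamination `ρ`. -/
lemma rnDerivSqMoment_mixture_le (μ ρ : Measure Ω) [IsProbabilityMeasure μ]
    [IsProbabilityMeasure ρ] {a b : ℝ≥0∞} (hab : a + b = 1) :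
    rnDerivSqMoment (a • μ + b • ρ) μ ≤ 1 + b ^ 2 * rnDerivSqMoment ρ μ := by
  have ha : a ≠ ∞ := ne_top_of_le_ne_top ENNReal.one_ne_top (hab ▸ le_self_add)
  have hb : b ≠ ∞ := ne_top_of_le_ne_top ENNReal.one_ne_top (hab ▸ le_add_self)
  have hμ := Measure.smul_finite μ ha
  have hρ := Measure.smul_finite ρ hb
  have hq := Measure.measurable_rnDeriv ρ μ
  have rnDeriv_mixture : (a • μ + b • ρ).rnDeriv μ =ᵐ[μ] fun x => a + b * ρ.rnDeriv μ x := by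
    filter_upwards [Measure.rnDeriv_add (a • μ) (b • ρ) μ,
      Measure.rnDeriv_smul_left_of_ne_top μ μ ha, Measure.rnDeriv_self μ,
      Measure.rnDeriv_smul_left_of_ne_top ρ μ hb] with x hadd hsmul_a hself hsmul_b
    simp [hadd, hsmul_a, hself, hsmul_b]
  calc ∫⁻ x, (a • μ + b • ρ).rnDeriv μ x ^ 2 ∂μ
      = ∫⁻ x, (a + b * ρ.rnDeriv μ x) ^ 2 ∂μ :=
        lintegral_congr_ae (rnDeriv_mixture.fun_comp (· ^ 2))
    _ = ∫⁻ x, (a ^ 2 + 2 * a * b * ρ.rnDeriv μ x + b ^ 2 * ρ.rnDeriv μ x ^ 2) ∂μ := by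
        congr 1 with x
        ring
    _ = a ^ 2 + 2 * a * b * ∫⁻ x, ρ.rnDeriv μ x ∂μ + b ^ 2 * ∫⁻ x, ρ.rnDeriv μ x ^ 2 ∂μ := by
        rw [lintegral_add_left (by fun_prop), lintegral_add_left (by fun_prop),
          lintegral_const_mul _ hq, lintegral_const_mul _ (by fun_prop), lintegral_const,
          measure_univ, mul_one]
    _ ≤ a ^ 2 + 2 * a * b * 1 + b ^ 2 * ∫⁻ x, ρ.rnDeriv μ x ^ 2 ∂μ := by
        gcongr
        exact Measure.lintegral_rnDeriv_le.trans_eq measure_univ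
    _ ≤ (a + b) ^ 2 + b ^ 2 * ∫⁻ x, ρ.rnDeriv μ x ^ 2 ∂μ := by
        gcongr
        rw [add_sq, mul_one]
        exact le_self_add
    _ = 1 + b ^ 2 * rnDerivSqMoment ρ μ := by rw [hab, one_pow, rnDerivSqMoment]

end LikelihoodRatio

section Product

variable {ι : Type*} [Fintype ι] {Ω : ι → Type*} [∀ i, MeasurableSpace (Ω i)]
  (μ : ∀ i, Measure (Ω i)) [∀ i, IsProbabilityMeasure (μ i)]

lemma lintegral_pi_prod {p : ∀ i, Ω i → ℝ≥0∞} (hp : ∀ i, Measurable (p i)) :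
    ∫⁻ z, ∏ i, p i (z i) ∂(Measure.pi μ) = ∏ i, ∫⁻ x, p i x ∂(μ i) := by
  have hind : iIndepFun (fun i (z : ∀ i, Ω i) => p i (z i)) (Measure.pi μ) :=
    iIndepFun_pi fun i => (hp i).aemeasurable
  rw [lintegral_prod_eq_prod_lintegral_of_indepFun Finset.univ _ hind
    fun i => (hp i).comp (measurable_pi_apply i)]
  exact Finset.prod_congr rfl fun i _ => (measurePreserving_eval μ i).lintegral_comp (hp i)

lemma pi_withDensity {p : ∀ i, Ω i → ℝ≥0∞} (hp : ∀ i, Measurable (p i))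
    [∀ i, SigmaFinite ((μ i).withDensity (p i))] :
    Measure.pi (fun i => (μ i).withDensity (p i)) =
      (Measure.pi μ).withDensity fun z => ∏ i, p i (z i) := by
  classical
  refine Measure.pi_eq fun A hA => ?_
  have indicator_prod (z : ∀ i, Ω i) : (Set.univ.pi A).indicator (fun z => ∏ i, p i (z i)) z =
      ∏ i, (A i).indicator (p i) (z i) := by
    simp only [Set.indicator_apply, Finset.prod_ite_zero, Set.mem_univ_pi, Finset.mem_univ,
      forall_const]
  rw [withDensity_apply _ (MeasurableSet.univ_pi hA),
    ← lintegral_indicator (MeasurableSet.univ_pi hA), lintegral_congr indicator_prod,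
    lintegral_pi_prod μ fun i => (hp i).indicator (hA i)]
  exact Finset.prod_congr rfl fun i _ => by
    rw [withDensity_apply _ (hA i), lintegral_indicator (hA i)]

variable {μ} {ν : ∀ i, Measure (Ω i)} [∀ i, SigmaFinite (ν i)]

lemma pi_eq_withDensity_prod_rnDeriv (h : ∀ i, ν i ≪ μ i) :
    Measure.pi ν = (Measure.pi μ).withDensity fun z => ∏ i, (ν i).rnDeriv (μ i) (z i) := by
  rw [← pi_withDensity μ fun i => Measure.measurable_rnDeriv (ν i) (μ i)]
  congr 1 with i : 1
  exact (Measure.withDensity_rnDeriv_eq _ _ (h i)).symm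

lemma pi_absolutelyContinuous (h : ∀ i, ν i ≪ μ i) : Measure.pi ν ≪ Measure.pi μ := by
  rw [pi_eq_withDensity_prod_rnDeriv h]
  exact withDensity_absolutelyContinuous _ _

lemma rnDerivSqMoment_pi (h : ∀ i, ν i ≪ μ i) :
    rnDerivSqMoment (Measure.pi ν) (Measure.pi μ) = ∏ i, rnDerivSqMoment (ν i) (μ i) := by
  have rnDeriv_pi : (Measure.pi ν).rnDeriv (Measure.pi μ) =ᵐ[Measure.pi μ]
      fun z => ∏ i, (ν i).rnDeriv (μ i) (z i) := by
    rw [pi_eq_withDensity_prod_rnDeriv h]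
    exact Measure.rnDeriv_withDensity _ (by fun_prop)
  calc ∫⁻ z, (Measure.pi ν).rnDeriv (Measure.pi μ) z ^ 2 ∂(Measure.pi μ)
      = ∫⁻ z, ∏ i, (ν i).rnDeriv (μ i) (z i) ^ 2 ∂(Measure.pi μ) := by
        refine lintegral_congr_ae ?_
        filter_upwards [rnDeriv_pi] with z hz
        rw [hz, Finset.prod_pow]
    _ = ∏ i, rnDerivSqMoment (ν i) (μ i) :=
        lintegral_pi_prod μ fun i => (Measure.measurable_rnDeriv (ν i) (μ i)).pow_const 2

end Product

section Privacy

variable {𝔛 : Type*} [MeasurableSpace 𝔛] {α : ℝ}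

section Channel

variable {𝔷 : Type*} [MeasurableSpace 𝔷] {Q : Kernel 𝔛 𝔷}

lemma IsLocallyDP.bind_le (hQ : IsLocallyDP α 0 Q) (P P' : Measure 𝔛) [IsProbabilityMeasure P]
    [IsProbabilityMeasure P'] : P'.bind Q ≤ ENNReal.ofReal (Real.exp α) • P.bind Q := by
  refine Measure.le_iff.2 fun A hA => ?_
  rw [Measure.smul_apply, Measure.bind_apply hA Q.aemeasurable,
    Measure.bind_apply hA Q.aemeasurable, smul_eq_mul]
  calc ∫⁻ y, Q y A ∂P' = ∫⁻ _, (∫⁻ y, Q y A ∂P') ∂P := by simp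
    _ ≤ ∫⁻ x, (∫⁻ _, ENNReal.ofReal (Real.exp α) * Q x A ∂P') ∂P := by
      gcongr with x y
      simpa using hQ y x A hA
    _ = ENNReal.ofReal (Real.exp α) * ∫⁻ x, Q x A ∂P := by
      simp [lintegral_const_mul _ (Q.measurable_coe hA)]

lemma IsLocallyDP.bind_absolutelyContinuous (hQ : IsLocallyDP α 0 Q) (P P' : Measure 𝔛)
    [IsProbabilityMeasure P] [IsProbabilityMeasure P'] : P'.bind Q ≪ P.bind Q :=
  (Measure.absolutelyContinuous_of_le (hQ.bind_le P P')).trans Measure.smul_absolutelyContinuous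

lemma IsLocallyDP.rnDerivSqMoment_bind_mixture_le [IsMarkovKernel Q] (hQ : IsLocallyDP α 0 Q)
    (P P' : Measure 𝔛) [IsProbabilityMeasure P] [IsProbabilityMeasure P'] {a b : ℝ≥0∞}
    (hab : a + b = 1) :
    rnDerivSqMoment ((a • P + b • P').bind Q) (P.bind Q) ≤
      1 + b ^ 2 * ENNReal.ofReal (Real.exp α) := by
  rw [Measure.comp_add, Measure.comp_smul, Measure.comp_smul]
  refine (rnDerivSqMoment_mixture_le _ _ hab).trans ?_
  gcongr
  exact rnDerivSqMoment_le_of_le_smul (hQ.bind_le P P')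

end Channel

lemma isProbabilityMeasure_mixture (P P' : Measure 𝔛) [IsProbabilityMeasure P]
    [IsProbabilityMeasure P'] {a b : ℝ≥0∞} (hab : a + b = 1) :
    IsProbabilityMeasure (a • P + b • P') :=
  ⟨by simpa using hab⟩

lemma rnDerivSqMoment_pi_bind_mixture_le {ι : Type*} [Fintype ι] {𝔷 : ι → Type*}
    [∀ i, MeasurableSpace (𝔷 i)] {Q : ∀ i, Kernel 𝔛 (𝔷 i)} [∀ i, IsMarkovKernel (Q i)]
    (hQ : ∀ i, IsLocallyDP α 0 (Q i)) (P P' : Measure 𝔛) [IsProbabilityMeasure P]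
    [IsProbabilityMeasure P'] {a b : ℝ≥0∞} (hab : a + b = 1) :
    rnDerivSqMoment (Measure.pi fun i => (a • P + b • P').bind (Q i))
      (Measure.pi fun i => P.bind (Q i)) ≤
        (1 + b ^ 2 * ENNReal.ofReal (Real.exp α)) ^ Fintype.card ι := by
  have := isProbabilityMeasure_mixture P P' hab
  rw [rnDerivSqMoment_pi fun i => (hQ i).bind_absolutelyContinuous P _]
  exact Finset.prod_le_pow_card _ _ _ fun i _ => (hQ i).rnDerivSqMoment_bind_mixture_le P P' hab

end Privacy

section Density

/-- Probability densities with respect to Lebesgue measure. Integrability is not a field, since a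
function which is not integrable has Bochner integral `0`. -/
structure IsProbDensity (f : ℝ → ℝ) : Prop where
  measurable : Measurable f
  nonneg : ∀ x, 0 ≤ f x
  integral_eq_one : ∫ x, f x = 1

variable {f g : ℝ → ℝ} {a b : ℝ}

lemma IsProbDensity.integrable (hf : IsProbDensity f) : Integrable f :=
  Integrable.of_integral_ne_zero (hf.integral_eq_one ▸ one_ne_zero)

lemma IsProbDensity.isProbabilityMeasure (hf : IsProbDensity f) :
    IsProbabilityMeasure (densityLaw f) := by
  constructor
  rw [densityLaw, withDensity_apply _ MeasurableSet.univ, Measure.restrict_univ,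
    ← ofReal_integral_eq_lintegral_ofReal hf.integrable (ae_of_all _ hf.nonneg),
    hf.integral_eq_one, ENNReal.ofReal_one]

lemma IsProbDensity.smul_add_smul (hf : IsProbDensity f) (hg : IsProbDensity g) (ha : 0 ≤ a)
    (hb : 0 ≤ b) (hab : a + b = 1) : IsProbDensity (a • f + b • g) where
  measurable := (hf.measurable.const_smul a).add (hg.measurable.const_smul b)
  nonneg x := add_nonneg (mul_nonneg ha (hf.nonneg x)) (mul_nonneg hb (hg.nonneg x))
  integral_eq_one := by
    rw [integral_add' (hf.integrable.smul a) (hg.integrable.smul b)]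
    simp [integral_const_mul, hf.integral_eq_one, hg.integral_eq_one, hab]

lemma densityLaw_smul_add_smul (hf : IsProbDensity f) (hg : IsProbDensity g) (ha : 0 ≤ a)
    (hb : 0 ≤ b) :
    densityLaw (a • f + b • g) =
      ENNReal.ofReal a • densityLaw f + ENNReal.ofReal b • densityLaw g := by
  have hfm := hf.measurable
  have hgm := hg.measurable
  unfold densityLaw
  rw [← withDensity_smul _ (by fun_prop), ← withDensity_smul _ (by fun_prop),
    ← withDensity_add_left (by fun_prop)]
  congr 1 with x
  simp only [Pi.add_apply, Pi.smul_apply, smul_eq_mul]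
  rw [ENNReal.ofReal_add (mul_nonneg ha (hf.nonneg x)) (mul_nonneg hb (hg.nonneg x)),
    ENNReal.ofReal_mul ha, ENNReal.ofReal_mul hb]

end Density

section MinimaxRisk

variable {n : ℕ} {α : ℝ} {f g : ℝ → ℝ} {a b : ℝ}

section Channels

variable {𝔷 : Fin n → Type*} [∀ i, MeasurableSpace (𝔷 i)] {Q : ∀ i, Kernel ℝ (𝔷 i)}
  [∀ i, IsMarkovKernel (Q i)]

lemma IsProbDensity.isProbabilityMeasure_viewsLaw (hf : IsProbDensity f) :
    IsProbabilityMeasure (viewsLaw Q f) := by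
  have := hf.isProbabilityMeasure
  unfold viewsLaw
  infer_instance

lemma viewsLaw_absolutelyContinuous (hQ : ∀ i, IsLocallyDP α 0 (Q i)) (hf : IsProbDensity f)
    (hg : IsProbDensity g) : viewsLaw Q g ≪ viewsLaw Q f := by
  have := hf.isProbabilityMeasure
  have := hg.isProbabilityMeasure
  exact pi_absolutelyContinuous fun i => (hQ i).bind_absolutelyContinuous _ _

lemma rnDerivSqMoment_viewsLaw_mixture_le (hQ : ∀ i, IsLocallyDP α 0 (Q i))
    (hf : IsProbDensity f) (hg : IsProbDensity g) (ha : 0 ≤ a) (hb : 0 ≤ b) (hab : a + b = 1) :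
    rnDerivSqMoment (viewsLaw Q (a • f + b • g)) (viewsLaw Q f) ≤
      ENNReal.ofReal (Real.exp (n * (b ^ 2 * Real.exp α))) := by
  have := hf.isProbabilityMeasure
  have := hg.isProbabilityMeasure
  calc rnDerivSqMoment (viewsLaw Q (a • f + b • g)) (viewsLaw Q f)
      ≤ (1 + ENNReal.ofReal b ^ 2 * ENNReal.ofReal (Real.exp α)) ^ n := by
        unfold viewsLaw
        rw [densityLaw_smul_add_smul hf hg ha hb]
        simpa using rnDerivSqMoment_pi_bind_mixture_le hQ (densityLaw f) (densityLaw g)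
          (by rw [← ENNReal.ofReal_add ha hb, hab, ENNReal.ofReal_one])
    _ = ENNReal.ofReal ((b ^ 2 * Real.exp α + 1) ^ n) := by
        rw [ENNReal.ofReal_pow (by positivity), ENNReal.ofReal_add (by positivity) zero_le_one,
          ENNReal.ofReal_mul (by positivity), ENNReal.ofReal_pow hb, ENNReal.ofReal_one, add_comm]
    _ ≤ ENNReal.ofReal (Real.exp (n * (b ^ 2 * Real.exp α))) := by
        rw [Real.exp_nat_mul]
        gcongr
        exact Real.add_one_le_exp _

lemma sq_sub_le_meanSquaredError_mixture (hQ : ∀ i, IsLocallyDP α 0 (Q i))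
    {ℓ : (∀ i, 𝔷 i) → ℝ} (hℓ : Measurable ℓ) (t : ℝ) (hf : IsProbDensity f)
    (hg : IsProbDensity g) (ha : 0 ≤ a) (hb : 0 ≤ b) (hab : a + b = 1) :
    ENNReal.ofReal ((b * (g t - f t)) ^ 2) ≤
      2 * (ENNReal.ofReal (Real.exp (n * (b ^ 2 * Real.exp α))) * meanSquaredError Q ℓ t f +
        meanSquaredError Q ℓ t (a • f + b • g)) := by
  have hmix := hf.smul_add_smul hg ha hb hab
  have := hf.isProbabilityMeasure_viewsLaw (Q := Q)
  have := hmix.isProbabilityMeasure_viewsLaw (Q := Q)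
  have gap : (a • f + b • g) t - f t = b * (g t - f t) := by
    simp only [Pi.add_apply, Pi.smul_apply, smul_eq_mul]
    linear_combination f t * hab
  rw [← gap]
  refine (sq_sub_le_rnDerivSqMoment_mul_risk_add_risk (viewsLaw_absolutelyContinuous hQ hf hmix)
    hℓ (f t) _).trans ?_
  unfold meanSquaredError
  gcongr
  exact rnDerivSqMoment_viewsLaw_mixture_le hQ hf hg ha hb hab

end Channels

lemma le_privateMinimaxRisk_of_mixture_mem (t : ℝ) {P : Set (ℝ → ℝ)} (hf : IsProbDensity f)
    (hg : IsProbDensity g) (ha : 0 ≤ a) (hb : 0 ≤ b) (hab : a + b = 1) (hf_mem : f ∈ P)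
    (hmix_mem : a • f + b • g ∈ P) :
    ENNReal.ofReal ((b * (g t - f t)) ^ 2 / (2 * (Real.exp (n * (b ^ 2 * Real.exp α)) + 1))) ≤
      privateMinimaxRisk.{u} α 0 n t P := by
  refine le_iInf fun 𝔷 => le_iInf fun _ => le_iInf fun Q => le_iInf fun _ => le_iInf fun hQ =>
    le_iInf fun ℓ => le_iInf fun hℓ => ?_
  have hle {h : ℝ → ℝ} (hh : h ∈ P) :
      meanSquaredError Q ℓ t h ≤ ⨆ f ∈ P, meanSquaredError Q ℓ t f :=
    le_iSup₂ (f := fun f (_ : f ∈ P) => meanSquaredError Q ℓ t f) h hh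
  rw [ENNReal.ofReal_div_of_pos (by positivity)]
  refine ENNReal.div_le_of_le_mul' ((sq_sub_le_meanSquaredError_mixture hQ hℓ t hf hg ha hb
    hab).trans ?_)
  rw [ENNReal.ofReal_mul zero_le_two, ENNReal.ofReal_add (Real.exp_nonneg _) zero_le_one,
    ENNReal.ofReal_ofNat, ENNReal.ofReal_one, mul_assoc, add_one_mul]
  gcongr
  · exact hle hf_mem
  · exact hle hmix_mem

end MinimaxRisk

section Fourier

variable {f g : ℝ → ℝ}

lemma fourierTransform_eq_fourierIntegral (f : ℝ → ℝ) :
    fourierTransform f = VectorFourier.fourierIntegral Real.probChar volume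
      (-LinearMap.mul ℝ ℝ) fun x => (f x : ℂ) := by
  ext ω
  rw [VectorFourier.fourierIntegral_probChar, fourierTransform]
  congr 1 with x
  simp [mul_comm, mul_left_comm]

lemma fourierTransform_add (hf : Integrable f) (hg : Integrable g) :
    fourierTransform (f + g) = fourierTransform f + fourierTransform g := by
  simp only [fourierTransform_eq_fourierIntegral]
  rw [← VectorFourier.fourierIntegral_add Real.continuous_probChar (by fun_prop) hf.ofReal
    hg.ofReal]
  congr 1 with x
  simp

lemma fourierTransform_smul (c : ℝ) (f : ℝ → ℝ) :
    fourierTransform (c • f) = c • fourierTransform f := by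
  ext ω
  simp only [fourierTransform, Pi.smul_apply, ← integral_smul]
  congr 1 with x
  simp only [smul_eq_mul, Complex.ofReal_mul, Complex.real_smul]
  ring

lemma continuous_fourierTransform (hf : Integrable f) : Continuous (fourierTransform f) := by
  rw [fourierTransform_eq_fourierIntegral]
  exact VectorFourier.fourierIntegral_continuous Real.continuous_probChar (by fun_prop) hf.ofReal

/-- The homogeneous Sobolev seminorm `‖|ω| ^ s 𝓕[f](ω)‖` in `L²(dω)`, with values in `[0, ∞]`. -/
noncomputable def sobolevSeminorm (s : ℝ) (f : ℝ → ℝ) : ℝ≥0∞ :=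
  eLpNorm (fun ω => |ω| ^ s • fourierTransform f ω) 2 volume

lemma sobolevSeminorm_sq (s : ℝ) (f : ℝ → ℝ) :
    sobolevSeminorm s f ^ 2 =
      ∫⁻ ω : ℝ, ENNReal.ofReal (‖fourierTransform f ω‖ ^ 2 * |ω| ^ (2 * s)) := by
  have sq_eq_lintegral :=
    eLpNorm_nnreal_pow_eq_lintegral (μ := volume) (p := 2)
      (f := fun ω => |ω| ^ s • fourierTransform f ω) two_ne_zero
  simp only [NNReal.coe_ofNat, ENNReal.coe_ofNat, ENNReal.rpow_two] at sq_eq_lintegral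
  rw [sobolevSeminorm, sq_eq_lintegral]
  congr 1 with ω
  rw [← ofReal_norm, ← ENNReal.ofReal_pow (norm_nonneg _), norm_smul, mul_pow,
    Real.norm_of_nonneg (by positivity), ← Real.rpow_mul_natCast (abs_nonneg ω), mul_comm,
    Nat.cast_ofNat, mul_comm s]

lemma sobolevSeminorm_add_le (s : ℝ) (hf : Integrable f) (hg : Integrable g) :
    sobolevSeminorm s (f + g) ≤ sobolevSeminorm s f + sobolevSeminorm s g := by
  have hmeas {h : ℝ → ℝ} (hh : Integrable h) :
      AEStronglyMeasurable (fun ω => |ω| ^ s • fourierTransform h ω) :=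
    (by fun_prop : Measurable fun ω : ℝ => |ω| ^ s).aestronglyMeasurable.smul
      (continuous_fourierTransform hh).aestronglyMeasurable
  unfold sobolevSeminorm
  rw [fourierTransform_add hf hg]
  simpa [Pi.add_def] using eLpNorm_add_le (hmeas hf) (hmeas hg) one_le_two

lemma sobolevSeminorm_smul (s c : ℝ) (f : ℝ → ℝ) :
    sobolevSeminorm s (c • f) = ‖c‖ₑ * sobolevSeminorm s f := by
  unfold sobolevSeminorm
  rw [fourierTransform_smul, ← eLpNorm_const_smul]
  congr 1 with ω
  simp [mul_left_comm]

end Fourier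

section SobolevClass

variable {s L L₁ L₂ a b : ℝ} {f g : ℝ → ℝ}

lemma mem_sobolevClass_iff (hL : 0 ≤ L) :
    f ∈ sobolevClass s L ↔ Continuous f ∧ IsProbDensity f ∧
      sobolevSeminorm s f ≤ ENNReal.ofReal (√(2 * Real.pi) * L) := by
  have seminorm_le_iff : sobolevSeminorm s f ≤ ENNReal.ofReal (√(2 * Real.pi) * L) ↔
      ∫⁻ ω : ℝ, ENNReal.ofReal (‖fourierTransform f ω‖ ^ 2 * |ω| ^ (2 * s)) ≤
        ENNReal.ofReal (2 * Real.pi * L ^ 2) := by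
    rw [← sobolevSeminorm_sq, ← Real.sq_sqrt (show 0 ≤ 2 * Real.pi by positivity), ← mul_pow,
      ENNReal.ofReal_pow (by positivity), Real.sqrt_sq (by positivity),
      ENNReal.pow_le_pow_left_iff two_ne_zero]
  rw [seminorm_le_iff]
  exact ⟨fun ⟨hcont, hnonneg, _, hone, hle⟩ => ⟨hcont, ⟨hcont.measurable, hnonneg, hone⟩, hle⟩,
    fun ⟨hcont, hf, hle⟩ => ⟨hcont, hf.nonneg, hf.integrable, hf.integral_eq_one, hle⟩⟩

lemma sobolevClass_mono (hL₁ : 0 ≤ L₁) (hL : L₁ ≤ L₂) : sobolevClass s L₁ ⊆ sobolevClass s L₂ :=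
  fun _ ⟨hcont, hnonneg, hint, hone, hle⟩ => ⟨hcont, hnonneg, hint, hone, hle.trans (by gcongr)⟩

lemma smul_add_smul_mem_sobolevClass (hL₁ : 0 ≤ L₁) (hL₂ : 0 ≤ L₂)
    (hf : f ∈ sobolevClass s L₁) (hg : g ∈ sobolevClass s L₂) (ha : 0 ≤ a) (hb : 0 ≤ b)
    (hab : a + b = 1) : a • f + b • g ∈ sobolevClass s (a * L₁ + b * L₂) := by
  rw [mem_sobolevClass_iff (by positivity)] at *
  obtain ⟨hf_cont, hf_dens, hf_le⟩ := hf
  obtain ⟨hg_cont, hg_dens, hg_le⟩ := hg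
  refine ⟨(hf_cont.const_smul a).add (hg_cont.const_smul b),
    hf_dens.smul_add_smul hg_dens ha hb hab, ?_⟩
  calc sobolevSeminorm s (a • f + b • g)
      ≤ sobolevSeminorm s (a • f) + sobolevSeminorm s (b • g) :=
        sobolevSeminorm_add_le s (hf_dens.integrable.smul a) (hg_dens.integrable.smul b)
    _ ≤ ENNReal.ofReal a * ENNReal.ofReal (√(2 * Real.pi) * L₁) +
        ENNReal.ofReal b * ENNReal.ofReal (√(2 * Real.pi) * L₂) := by
        rw [sobolevSeminorm_smul, sobolevSeminorm_smul, Real.enorm_of_nonneg ha,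
          Real.enorm_of_nonneg hb]
        gcongr
    _ = ENNReal.ofReal (√(2 * Real.pi) * (a * L₁ + b * L₂)) := by
        rw [← ENNReal.ofReal_mul ha, ← ENNReal.ofReal_mul hb,
          ← ENNReal.ofReal_add (by positivity) (by positivity)]
        congr 1
        ring

end SobolevClass

section Gaussian

variable {s L : ℝ} {v w : NNReal}

lemma lintegral_exp_neg_mul_sq_mul_abs_rpow {b : ℝ} (hs : -1 / 2 < s) (hb : 0 < b) :
    ∫⁻ ω : ℝ, ENNReal.ofReal (Real.exp (-b * ω ^ 2) * |ω| ^ (2 * s)) =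
      ENNReal.ofReal (b ^ (-(s + 1 / 2)) * Real.Gamma (s + 1 / 2)) := by
  have integral_eq : ∫ ω : ℝ, Real.exp (-b * ω ^ 2) * |ω| ^ (2 * s) =
      b ^ (-(s + 1 / 2)) * Real.Gamma (s + 1 / 2) := by
    have abs_comp := integral_comp_abs
      (f := fun x : ℝ => x ^ (2 * s) * Real.exp (-b * x ^ (2 : ℝ)))
    rw [integral_rpow_mul_exp_neg_mul_rpow two_pos (by linarith) hb] at abs_comp
    simp only [Real.rpow_two, sq_abs] at abs_comp
    simp only [mul_comm (Real.exp _)]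
    rw [abs_comp, show -(2 * s + 1) / 2 = -(s + 1 / 2) by ring,
      show (2 * s + 1) / 2 = s + 1 / 2 by ring]
    ring
  have integral_pos : 0 < b ^ (-(s + 1 / 2)) * Real.Gamma (s + 1 / 2) :=
    mul_pos (Real.rpow_pos_of_pos hb _) (Real.Gamma_pos_of_pos (by linarith))
  rw [← integral_eq, ofReal_integral_eq_lintegral_ofReal
    (Integrable.of_integral_ne_zero (integral_eq ▸ integral_pos.ne'))
    (ae_of_all _ fun ω => by positivity)]

lemma fourierTransform_gaussianPDFReal (t : ℝ) (hv : v ≠ 0) (ω : ℝ) :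
    fourierTransform (gaussianPDFReal t v) ω =
      Complex.exp (ω * t * Complex.I - v * ω ^ 2 / 2) := by
  rw [← charFun_gaussianReal, charFun_apply_real, integral_gaussianReal_eq_integral_smul hv]
  refine integral_congr_ae (ae_of_all _ fun x => ?_)
  simp only [Complex.real_smul]
  rw [mul_comm, show Complex.I * ω * x = ω * x * Complex.I by ring]

lemma sq_norm_fourierTransform_gaussianPDFReal (t : ℝ) (hv : v ≠ 0) (ω : ℝ) :
    ‖fourierTransform (gaussianPDFReal t v) ω‖ ^ 2 = Real.exp (-v * ω ^ 2) := by
  have real_add_imag : (ω * t * Complex.I - v * ω ^ 2 / 2 : ℂ) =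
      ((-(v * ω ^ 2 / 2) : ℝ) : ℂ) + ((ω * t : ℝ) : ℂ) * Complex.I := by
    push_cast
    ring
  rw [fourierTransform_gaussianPDFReal t hv, real_add_imag, Complex.exp_add, norm_mul,
    Complex.norm_exp_ofReal_mul_I, mul_one, Complex.norm_exp_ofReal, ← Real.exp_nat_mul]
  congr 1
  push_cast
  ring

lemma continuous_gaussianPDFReal (t : ℝ) (v : NNReal) : Continuous (gaussianPDFReal t v) := by
  unfold gaussianPDFReal
  fun_prop

lemma isProbDensity_gaussianPDFReal (t : ℝ) (hv : v ≠ 0) :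
    IsProbDensity (gaussianPDFReal t v) :=
  ⟨measurable_gaussianPDFReal t v, gaussianPDFReal_nonneg t v,
    integral_gaussianPDFReal_eq_one t hv⟩

lemma gaussianPDFReal_mem_sobolevClass_iff (hs : -1 / 2 < s) (t : ℝ) (hv : v ≠ 0) :
    gaussianPDFReal t v ∈ sobolevClass s L ↔
      (v : ℝ) ^ (-(s + 1 / 2)) * Real.Gamma (s + 1 / 2) ≤ 2 * Real.pi * L ^ 2 := by
  have fourier_le_iff : ∫⁻ ω : ℝ, ENNReal.ofReal
      (‖fourierTransform (gaussianPDFReal t v) ω‖ ^ 2 * |ω| ^ (2 * s)) ≤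
        ENNReal.ofReal (2 * Real.pi * L ^ 2) ↔
      (v : ℝ) ^ (-(s + 1 / 2)) * Real.Gamma (s + 1 / 2) ≤ 2 * Real.pi * L ^ 2 := by
    simp only [sq_norm_fourierTransform_gaussianPDFReal t hv]
    rw [lintegral_exp_neg_mul_sq_mul_abs_rpow hs (NNReal.coe_pos.2 (pos_iff_ne_zero.2 hv)),
      ENNReal.ofReal_le_ofReal_iff (by positivity)]
  exact ⟨fun h => fourier_le_iff.1 h.2.2.2.2, fun h => ⟨continuous_gaussianPDFReal t v,
    gaussianPDFReal_nonneg t v, integrable_gaussianPDFReal t v,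
    integral_gaussianPDFReal_eq_one t hv, fourier_le_iff.2 h⟩⟩

lemma exists_gaussianPDFReal_mem_sobolevClass (hs : -1 / 2 < s) (hL : 0 < L) :
    ∃ v : NNReal, v ≠ 0 ∧ ∀ t, gaussianPDFReal t v ∈ sobolevClass s L := by
  have hp : 0 < s + 1 / 2 := by linarith
  have hΓ := Real.Gamma_pos_of_pos hp
  have hx : 0 < (2 * Real.pi * L ^ 2 / Real.Gamma (s + 1 / 2)) ^ (-(s + 1 / 2)⁻¹) := by
    positivity
  refine ⟨Real.toNNReal _, (Real.toNNReal_pos.2 hx).ne', fun t =>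
    (gaussianPDFReal_mem_sobolevClass_iff hs t (Real.toNNReal_pos.2 hx).ne').2 (le_of_eq ?_)⟩
  rw [Real.coe_toNNReal _ hx.le, ← Real.rpow_mul (by positivity), neg_mul_neg,
    inv_mul_cancel₀ hp.ne', Real.rpow_one, div_mul_cancel₀ _ hΓ.ne']

lemma gaussianPDFReal_mul_mem_sobolevClass (hs : -1 / 2 < s) {t : ℝ} (hv : v ≠ 0)
    (hmem : gaussianPDFReal t v ∈ sobolevClass s L) {h : NNReal} (hh : h ≠ 0) :
    gaussianPDFReal t (v * h) ∈ sobolevClass s ((h : ℝ) ^ (-((s + 1 / 2) / 2)) * L) := by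
  rw [gaussianPDFReal_mem_sobolevClass_iff hs t hv] at hmem
  rw [gaussianPDFReal_mem_sobolevClass_iff hs t (mul_ne_zero hv hh)]
  have sq_scale : ((h : ℝ) ^ (-((s + 1 / 2) / 2))) ^ 2 = (h : ℝ) ^ (-(s + 1 / 2)) := by
    rw [← Real.rpow_mul_natCast h.coe_nonneg]
    congr 1
    push_cast
    ring
  calc ((v * h : NNReal) : ℝ) ^ (-(s + 1 / 2)) * Real.Gamma (s + 1 / 2)
      = (h : ℝ) ^ (-(s + 1 / 2)) * ((v : ℝ) ^ (-(s + 1 / 2)) * Real.Gamma (s + 1 / 2)) := by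
        rw [NNReal.coe_mul, Real.mul_rpow v.coe_nonneg h.coe_nonneg]
        ring
    _ ≤ (h : ℝ) ^ (-(s + 1 / 2)) * (2 * Real.pi * L ^ 2) := by gcongr
    _ = 2 * Real.pi * ((h : ℝ) ^ (-((s + 1 / 2) / 2)) * L) ^ 2 := by
        rw [mul_pow, sq_scale]
        ring

lemma gaussianPDFReal_self (t : ℝ) (v : NNReal) :
    gaussianPDFReal t v t = (√(2 * Real.pi * v))⁻¹ := by
  simp [gaussianPDFReal]

lemma one_div_le_sq_gaussianPDFReal_sub (t : ℝ) (hw : w ≠ 0) (hwv : 4 * w ≤ v) :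
    1 / (8 * Real.pi * w) ≤ (gaussianPDFReal t w t - gaussianPDFReal t v t) ^ 2 := by
  have : (0 : ℝ) < w := NNReal.coe_pos.2 (pos_iff_ne_zero.2 hw)
  have half_le : gaussianPDFReal t v t ≤ gaussianPDFReal t w t / 2 :=
    calc gaussianPDFReal t v t = (√(2 * Real.pi * v))⁻¹ := gaussianPDFReal_self t v
      _ ≤ (√(2 ^ 2 * (2 * Real.pi * w)))⁻¹ := by
        refine inv_anti₀ (by positivity) (Real.sqrt_le_sqrt ?_)
        calc 2 ^ 2 * (2 * Real.pi * w) = 2 * Real.pi * (4 * w) := by ring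
          _ ≤ 2 * Real.pi * v := by
            gcongr
            exact_mod_cast hwv
      _ = gaussianPDFReal t w t / 2 := by
        rw [Real.sqrt_mul (by positivity), Real.sqrt_sq zero_le_two, mul_inv,
          gaussianPDFReal_self, inv_mul_eq_div]
  calc 1 / (8 * Real.pi * w) = (gaussianPDFReal t w t / 2) ^ 2 := by
        rw [gaussianPDFReal_self, div_pow, inv_pow, Real.sq_sqrt (by positivity)]
        field_simp
        norm_num
    _ ≤ (gaussianPDFReal t w t - gaussianPDFReal t v t) ^ 2 := by
        have := gaussianPDFReal_nonneg t w t
        gcongr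
        linarith

end Gaussian

section LowerBound

variable {s L : ℝ} {v : NNReal}

/-- The weight `h ^ ((s + 1 / 2) / 2)` is what makes the seminorm of the narrow component
independent of its bandwidth `h`. -/
lemma gaussian_mixture_mem_sobolevClass (hs : -1 / 2 < s) (hL : 0 ≤ L) {t : ℝ} (hv : v ≠ 0)
    (hmem : gaussianPDFReal t v ∈ sobolevClass s (L / 2)) {h : NNReal} (hh : h ≠ 0)
    (hh_le : h ≤ 1) :
    (1 - (h : ℝ) ^ ((s + 1 / 2) / 2)) • gaussianPDFReal t v +
      (h : ℝ) ^ ((s + 1 / 2) / 2) • gaussianPDFReal t (v * h) ∈ sobolevClass s L := by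
  have hh_pos : (0 : ℝ) < h := NNReal.coe_pos.2 (pos_iff_ne_zero.2 hh)
  set b : ℝ := (h : ℝ) ^ ((s + 1 / 2) / 2) with hb
  have hb_pos : 0 < b := Real.rpow_pos_of_pos hh_pos _
  have hb_le : b ≤ 1 := Real.rpow_le_one h.coe_nonneg hh_le (by linarith)
  have narrow_mem : gaussianPDFReal t (v * h) ∈ sobolevClass s (b⁻¹ * (L / 2)) := by
    rw [hb, ← Real.rpow_neg h.coe_nonneg]
    exact gaussianPDFReal_mul_mem_sobolevClass hs hv hmem hh
  refine sobolevClass_mono (by positivity) ?_ (smul_add_smul_mem_sobolevClass (by positivity)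
    (by positivity) hmem narrow_mem (by linarith) hb_pos.le (by ring))
  rw [mul_inv_cancel_left₀ hb_pos.ne']
  nlinarith

lemma le_privateMinimaxRisk_sobolevClass (hs : -1 / 2 < s) (hL : 0 ≤ L) (α : ℝ) (n : ℕ)
    {t : ℝ} (hv : v ≠ 0) (hmem : gaussianPDFReal t v ∈ sobolevClass s (L / 2)) {h : NNReal}
    (hh : h ≠ 0) (hh_le : 4 * h ≤ 1) :
    ENNReal.ofReal ((h : ℝ) ^ (s - 1 / 2) /
        (16 * Real.pi * v * (Real.exp (n * ((h : ℝ) ^ (s + 1 / 2) * Real.exp α)) + 1))) ≤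
      privateMinimaxRisk.{u} α 0 n t (sobolevClass s L) := by
  have hh_pos : (0 : ℝ) < h := NNReal.coe_pos.2 (pos_iff_ne_zero.2 hh)
  have : (0 : ℝ) < v := NNReal.coe_pos.2 (pos_iff_ne_zero.2 hv)
  have hh_le_one : h ≤ 1 := (le_mul_of_one_le_left' (by norm_num)).trans hh_le
  set b : ℝ := (h : ℝ) ^ ((s + 1 / 2) / 2) with hb
  have hb_nonneg : 0 ≤ b := by positivity
  have hb_le : b ≤ 1 := Real.rpow_le_one h.coe_nonneg hh_le_one (by linarith)
  have hb_sq : b ^ 2 = (h : ℝ) ^ (s + 1 / 2) := by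
    rw [hb, ← Real.rpow_mul_natCast h.coe_nonneg]
    congr 1
    push_cast
    ring
  have wide_mem : gaussianPDFReal t v ∈ sobolevClass s L :=
    sobolevClass_mono (by positivity) (by linarith) hmem
  refine le_trans (ENNReal.ofReal_le_ofReal ?_) (le_privateMinimaxRisk_of_mixture_mem t
    (isProbDensity_gaussianPDFReal t hv) (isProbDensity_gaussianPDFReal t (mul_ne_zero hv hh))
    (sub_nonneg.2 hb_le) hb_nonneg (sub_add_cancel 1 b) wide_mem
    (gaussian_mixture_mem_sobolevClass hs hL hv hmem hh hh_le_one))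
  have gap : 1 / (8 * Real.pi * (v * h)) ≤
      (gaussianPDFReal t (v * h) t - gaussianPDFReal t v t) ^ 2 := by
    refine one_div_le_sq_gaussianPDFReal_sub t (mul_ne_zero hv hh) ?_
    calc 4 * (v * h) = v * (4 * h) := by ring
      _ ≤ v := mul_le_of_le_one_right' hh_le
  rw [← hb_sq, mul_pow]
  calc (h : ℝ) ^ (s - 1 / 2) /
        (16 * Real.pi * v * (Real.exp (n * (b ^ 2 * Real.exp α)) + 1))
      = b ^ 2 * (1 / (8 * Real.pi * (v * h))) /
          (2 * (Real.exp (n * (b ^ 2 * Real.exp α)) + 1)) := by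
        rw [show s - 1 / 2 = s + 1 / 2 - 1 by ring, Real.rpow_sub_one hh_pos.ne', ← hb_sq]
        field_simp
        ring
    _ ≤ _ := by gcongr

end LowerBound

end PrivateDensity

open PrivateDensity in
theorem mainTheorem2_general {s L : ℝ} (hs : -1 / 2 < s) (hL : 0 < L) (α : ℝ) :
    ∃ C : ℝ, 0 < C ∧ ∀ (t : ℝ) (n : ℕ), 1 ≤ n →
      ENNReal.ofReal (C * (n : ℝ) ^ (-((2 * s - 1) / (2 * s + 1)))) ≤
        privateMinimaxRisk.{u} α 0 n t (sobolevClass s L) := by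
  obtain ⟨v, hv, hmem⟩ := exists_gaussianPDFReal_mem_sobolevClass hs (half_pos hL)
  have hp : 0 < s + 1 / 2 := by linarith
  have : (0 : ℝ) < v := NNReal.coe_pos.2 (pos_iff_ne_zero.2 hv)
  set K : ℝ := Real.exp ((1 / 4) ^ (s + 1 / 2) * Real.exp α)
  refine ⟨(1 / 4) ^ (s - 1 / 2) / (16 * Real.pi * v * (K + 1)), by positivity, fun t n hn => ?_⟩
  have hn_pos : (0 : ℝ) < n := by exact_mod_cast hn
  set h : NNReal := 1 / 4 * (n : NNReal) ^ (-(s + 1 / 2)⁻¹) with hh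
  have hh_le : 4 * h ≤ 1 := by
    rw [hh, ← mul_assoc, mul_one_div_cancel (by norm_num), one_mul]
    exact NNReal.rpow_le_one_of_one_le_of_nonpos (by exact_mod_cast hn) (by simpa using hp.le)
  have h_rpow (r : ℝ) : (h : ℝ) ^ r = (1 / 4) ^ r * (n : ℝ) ^ (-(r / (s + 1 / 2))) := by
    rw [hh]
    push_cast
    rw [Real.mul_rpow (by positivity) (by positivity), ← Real.rpow_mul hn_pos.le]
    congr 2
    ring
  convert le_privateMinimaxRisk_sobolevClass hs hL.le α n hv (hmem t)
    (h := h) (by positivity) hh_le using 2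
  have exponent : n * ((h : ℝ) ^ (s + 1 / 2) * Real.exp α) =
      (1 / 4) ^ (s + 1 / 2) * Real.exp α := by
    rw [h_rpow, div_self hp.ne', Real.rpow_neg_one]
    field_simp
  rw [exponent, h_rpow, show (2 * s - 1) / (2 * s + 1) = (s - 1 / 2) / (s + 1 / 2) by field_simp]
  ring

theorem mainTheorem2 (s : ℝ) (hs : 1 / 2 < s) (L : ℝ) (hL : 0 < L) (α : ℝ) (hα : 0 < α) :
    ∃ C : ℝ, 0 < C ∧ ∀ (t : ℝ) (n : ℕ), 1 ≤ n →
      ENNReal.ofReal (C * (n : ℝ) ^ (-((2 * s - 1) / (2 * s + 1)))) ≤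
        PrivateDensity.privateMinimaxRisk.{u} α 0 n t (PrivateDensity.sobolevClass s L) :=
  mainTheorem2_general (by linarith) hL α
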